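/- Let $p \equiv 1 \pmod 4$ be a prime, and write $p = x_1^2 + 4y_1^2$ with $x_1, y_1 \in \mathbb{Z}$ and $x_1 \equiv 1 \pmod 4$. Let $0 < a_1 < a_2 < \cdots < a_{(p-1)/4} < p$ be all the biquadratic residues modulo $p$ in the interval $(0,p)$, that is, all integers in $(0,p)$ that are congruent to a fourth power modulo $p$, and let $$W_p = \det\left[\left(\frac{a_i + a_j}{p}\right)\right]_{1 \le i, j \le (p-1)/4},$$ where $\left(\frac{\cdot}{p}\right)$ is the Legendre symbol. (i) If $p \equiv 5 \pmod 8$, then $\dfrac{-2W_p}{1 + x_1}$ is an integral square, i.e. the square of an integer. (ii) If $p \equiv 1 \pmod 8$ and $p = x_2^2 + 2y_2^2$ with $x_2, y_2 \in \mathbb{Z}$ and $x_2 \equiv 1 \pmod 4$, then $\dfrac{(-1)^{(p-1)/8}\, 2W_p}{(1 + x_1)x_2}$ is an integral square. -/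

import Mathlib

open Classical in
/-- The biquadratic residues modulo `p` in the interval `(0, p)`: the integers `0 < a < p`
that are congruent to a fourth power modulo `p`. -/
noncomputable def biquadraticResidues (p : ℕ) : Finset ℤ :=
  (Finset.Ioo (0 : ℤ) p).filter fun a => ∃ b : ℤ, b ^ 4 ≡ a [ZMOD p]

/-- The increasing enumeration `a₁ < a₂ < ⋯` of all biquadratic residues modulo `p` in `(0, p)`
(with indices starting at `0`). -/
noncomputable def biquadraticResidue (p : ℕ) (i : Fin (biquadraticResidues p).card) : ℤ :=
  (biquadraticResidues p).orderEmbOfFin rfl i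

/-- The determinant `W_p` of the matrix whose `(i, j)` entry is the Legendre symbol
of `a_i + a_j` modulo `p`. -/
noncomputable def biquadraticDet (p : ℕ) [Fact p.Prime] : ℤ :=
  Matrix.det (Matrix.of fun i j : Fin (biquadraticResidues p).card =>
    legendreSym p (biquadraticResidue p i + biquadraticResidue p j))

/-! Let `G` be the group of nonzero fourth powers and `χ` the quadratic character. As `χ` is 1 on
`G`, `χ (a + b) = χ (a / b + 1)`, so `W_p` is the group determinant of `f h = χ (h + 1)`, a function
invariant under `h ↦ h⁻¹`. Dedekind's formula makes it the product of the character sums of `f`. A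
character of order above two shares its sum with its inverse, so these sums contribute a square, of
an integer by Galois descent (`prod_charSum_isSquare`).

What remains is `Λ = ∑ f h` and, when `p ≡ 1 (mod 8)`, also `M = ∑ η h * f h` with `η (x ^ 4) = χ
x`. Second moments of Jacobsthal sums give `p = (2Λ + 1) ^ 2 + B ^ 2` and `p = M ^ 2 + 2 * B' ^ 2`.
Such representations are unique up to sign, and pairing `h` with `h⁻¹` fixes the signs modulo 4: `1
+ x₁ = -2Λ` and `(-1) ^ ((p - 1) / 8) * M = -x₂`. Both quotients then reduce to the square. -/

/-! ### Group determinants of even functions -/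

section GroupDeterminant

variable {G : Type*} [CommGroup G] [Fintype G]

/-- The value at the character `χ` of the Fourier transform of `f : G → ℤ`. -/
def charSum {L : Type*} [Field L] (f : G → ℤ) (χ : G →* Lˣ) : L :=
  ∑ a, (f a : L) * (χ a : L)

lemma charSum_inv {L : Type*} [Field L] {f : G → ℤ} (hf : ∀ a, f a⁻¹ = f a) (χ : G →* Lˣ) :
    charSum f χ⁻¹ = charSum f χ := by
  unfold charSum
  refine Fintype.sum_equiv (Equiv.inv G) _ _ fun a => ?_
  simp [hf]

lemma charSum_map {L : Type*} [Field L] (f : G → ℤ) (χ : G →* Lˣ) (σ : L →+* L) :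
    charSum f ((Units.map (σ : L →* L)).comp χ) = σ (charSum f χ) := by
  simp [charSum]

lemma isIntegral_charSum {L : Type*} [Field L] (f : G → ℤ) (χ : G →* Lˣ) :
    IsIntegral ℤ (charSum f χ) := by
  refine IsIntegral.sum _ fun a _ => IsIntegral.mul ?_ ?_
  · exact isIntegral_algebraMap (R := ℤ) (A := L) (x := f a)
  · refine IsIntegral.of_pow (n := Fintype.card G) Fintype.card_pos ?_
    rw [← Units.val_pow_eq_pow_val, ← map_pow, pow_card_eq_one, map_one]
    exact isIntegral_one

/-- Dedekind's factorization of the determinant of a finite abelian group. -/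
lemma groupDet_eq_prod_charSum {L : Type*} [Field L] [DecidableEq G]
    [HasEnoughRootsOfUnity L (Monoid.exponent G)] [Fintype (G →* Lˣ)]
    {f : G → ℤ} (hf : ∀ a, f a⁻¹ = f a) :
    ((Matrix.of fun a b : G => f (a / b)).det : L) = ∏ χ : G →* Lˣ, charSum f χ := by
  classical
  obtain ⟨e⟩ := CommGroup.monoidHom_mulEquiv_of_hasEnoughRootsOfUnity G L
  let V : Matrix G G L := Matrix.of fun a c => ((e.symm c a : Lˣ) : L)
  have hV : V.det ≠ 0 := by
    have h1 : LinearIndependent L (fun c : G => V.col c) := by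
      have h2 := linearIndependent_monoidHom G L
      have h3 := h2.comp (fun c : G => (Units.coeHom L).comp (e.symm c)) (by
        intro c d hcd
        apply e.symm.injective
        ext a
        exact DFunLike.congr_fun hcd a)
      exact h3
    have := Matrix.linearIndependent_cols_iff_isUnit.mp h1
    exact ((Matrix.isUnit_iff_isUnit_det V).mp this).ne_zero
  let M : Matrix G G L := (Matrix.of fun a b : G => f (a / b)).map (Int.castRingHom L)
  have hM : ((Matrix.of fun a b : G => f (a / b)).det : L) = M.det :=
    (Int.castRingHom L).map_det _
  -- Each character is an eigenvector. The substitution `b ↦ a / b` yields the sum at the inverse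
  -- character, which evenness of `f` identifies with the sum at the character.
  have hMV : M * V = V * Matrix.diagonal fun c => charSum f (e.symm c) := by
    ext a c
    rw [Matrix.mul_diagonal, Matrix.mul_apply, ← charSum_inv hf, charSum, Finset.mul_sum]
    refine Fintype.sum_equiv (Equiv.divLeft a) _ _ fun b => ?_
    have : (e.symm c a : L) ≠ 0 := Units.ne_zero _
    simp [M, V]
    field_simp
  have hdet := congrArg Matrix.det hMV
  rw [Matrix.det_mul, Matrix.det_mul, Matrix.det_diagonal, mul_comm] at hdet
  rw [hM, mul_left_cancel₀ hV hdet]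
  exact Fintype.prod_equiv e.symm.toEquiv _ _ fun _ => rfl

/-- Taking one factor per pair `{χ, χ⁻¹}` gives a square root. It is an algebraic integer, and
Galois automorphisms only permute the pairs, so it is a rational integer. -/
lemma prod_charSum_isSquare (L : Type*) [Field L] [Algebra ℚ L] [IsGalois ℚ L]
    [Fintype (G →* Lˣ)] [DecidableEq (G →* Lˣ)] {f : G → ℤ} (hf : ∀ a, f a⁻¹ = f a) :
    ∃ z : ℤ, ∏ χ : G →* Lˣ with χ ^ 2 ≠ 1, charSum f χ = (z : L) ^ 2 := by
  classical
  have : CharZero L := algebraRat.charZero L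
  let R : Finset (G →* Lˣ) := {χ | χ ^ 2 ≠ 1}
  let S : Finset (Sym2 (G →* Lˣ)) := R.image fun χ => s(χ, χ⁻¹)
  -- The average is symmetric, hence defined on all unordered pairs; on `{χ, χ⁻¹}` it is the common
  -- value.
  let Φ : Sym2 (G →* Lˣ) → L :=
    Sym2.lift ⟨fun χ ψ => (charSum f χ + charSum f ψ) / 2, fun χ ψ => by simp only [add_comm]⟩
  have hΦ (χ : G →* Lˣ) : Φ s(χ, χ⁻¹) = charSum f χ := by
    simp [Φ, charSum_inv hf]
  have hsq : ∏ χ ∈ R, charSum f χ = (∏ s ∈ S, Φ s) ^ 2 := by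
    rw [← Finset.prod_pow, ← Finset.prod_fiberwise_of_maps_to
      (g := fun χ => s(χ, χ⁻¹)) (t := S) fun χ h => Finset.mem_image_of_mem _ h]
    refine Finset.prod_congr rfl fun s hs => ?_
    obtain ⟨χ, hχ, rfl⟩ := Finset.mem_image.mp hs
    have hχ' : χ ^ 2 ≠ 1 := (Finset.mem_filter.mp hχ).2
    have hne : χ ≠ χ⁻¹ := fun h => hχ' (by
      rw [pow_two]; nth_rewrite 2 [h]; exact mul_inv_cancel χ)
    have : R.filter (fun ψ => s(ψ, ψ⁻¹) = s(χ, χ⁻¹)) = {χ, χ⁻¹} := by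
      ext ψ
      simp only [R, Finset.mem_filter, Finset.mem_univ, true_and, Finset.mem_insert,
        Finset.mem_singleton, Sym2.eq_iff]
      constructor
      · rintro ⟨-, h | h⟩
        · exact Or.inl h.1
        · exact Or.inr h.1
      · rintro (rfl | rfl)
        · exact ⟨hχ', Or.inl ⟨rfl, rfl⟩⟩
        · refine ⟨fun h => hχ' ?_, Or.inr ⟨rfl, inv_inv χ⟩⟩
          exact inv_eq_one.mp ((inv_pow χ 2).symm.trans h)
    rw [this, Finset.prod_pair hne, charSum_inv hf, hΦ, pow_two]
  have hint : IsIntegral ℤ (∏ s ∈ S, Φ s) := by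
    refine IsIntegral.prod _ fun s hs => ?_
    obtain ⟨χ, -, rfl⟩ := Finset.mem_image.mp hs
    rw [hΦ]
    exact isIntegral_charSum f χ
  have hfix (σ : L ≃ₐ[ℚ] L) : σ (∏ s ∈ S, Φ s) = ∏ s ∈ S, Φ s := by
    let τ : (G →* Lˣ) → (G →* Lˣ) := fun χ => (Units.map ((σ : L →+* L) : L →* L)).comp χ
    have hτ : Function.Injective τ := fun χ ψ h => by
      ext a
      have := congrArg Units.val (DFunLike.congr_fun h a)
      exact σ.injective this
    have hτS : Set.MapsTo (Sym2.map τ) S S := by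
      intro s hs
      obtain ⟨χ, hχ, rfl⟩ := Finset.mem_image.mp (Finset.mem_coe.mp hs)
      refine Finset.mem_coe.mpr (Finset.mem_image.mpr ⟨τ χ, ?_, ?_⟩)
      · refine Finset.mem_filter.mpr ⟨Finset.mem_univ _, fun h => (Finset.mem_filter.mp hχ).2 ?_⟩
        apply hτ
        rw [← MonoidHom.comp_one (Units.map ((σ : L →+* L) : L →* L))] at h
        simp only [τ, ← h]
        ext a
        simp [pow_two]
      · rw [Sym2.map_mk]
        congr 1
    have hinj := Sym2.map.injective hτ
    rw [map_prod]
    refine Finset.prod_nbij (Sym2.map τ) hτS hinj.injOn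
      (Finset.surjOn_of_injOn_of_card_le _ hτS hinj.injOn le_rfl) fun s _ => ?_
    induction s with
    | _ χ ψ =>
      have h (χ) : charSum f (τ χ) = σ (charSum f χ) := charSum_map f χ (σ : L →+* L)
      simp [Φ, h, map_ofNat σ 2]
  obtain ⟨q, hq⟩ := (InfiniteGalois.mem_bot_iff_fixed (k := ℚ) _).mpr hfix
  have hq' : algebraMap ℚ L q = ∏ s ∈ S, Φ s := hq
  rw [← hq'] at hint
  obtain ⟨z, hz⟩ := IsIntegrallyClosed.isIntegral_iff.mp
    ((isIntegral_algebraMap_iff (algebraMap ℚ L).injective).mp hint)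
  refine ⟨z, ?_⟩
  change ∏ χ ∈ R, charSum f χ = _
  rw [hsq, ← hq', ← hz]
  simp

/-- The determinant of an even integer-valued function on a finite abelian group is, up to the
factors at the characters of order at most two, the square of an integer. -/
lemma exists_groupDet_eq_prod_mul_sq (L : Type*) [Field L] [Algebra ℚ L] [IsGalois ℚ L]
    [DecidableEq G] [HasEnoughRootsOfUnity L (Monoid.exponent G)]
    [Fintype (G →* Lˣ)] [DecidableEq (G →* Lˣ)] {f : G → ℤ} (hf : ∀ a, f a⁻¹ = f a) :
    ∃ z : ℤ, ((Matrix.of fun a b : G => f (a / b)).det : L) =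
      (∏ χ : G →* Lˣ with χ ^ 2 = 1, charSum f χ) * z ^ 2 := by
  obtain ⟨z, hz⟩ := prod_charSum_isSquare L hf
  refine ⟨z, ?_⟩
  rw [groupDet_eq_prod_charSum hf, ← hz, Finset.prod_filter_mul_prod_filter_not]

end GroupDeterminant

theorem AlgebraicClosure.isGalois_rat : IsGalois ℚ (AlgebraicClosure ℚ) := by
  convert @IsAlgClosure.isGalois ℚ (AlgebraicClosure ℚ) _ _
    (AlgebraicClosure.instAlgebra ℚ) _ _
  -- Any two `ℚ`-algebra structures agree.
  exact Subsingleton.elim _ _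

/-! ### Jacobsthal sums and their second moments -/

section CharacterSums

lemma MonoidHom.sum_comp_eq_card_ker_mul {A B M : Type*} [Group A] [Group B] [Fintype A]
    [CommRing M] (f : A →* B) [Fintype f.range] (φ : f.range → M) :
    ∑ x, φ (f.rangeRestrict x) = Nat.card f.ker * ∑ y, φ y := by
  classical
  rw [← Finset.sum_fiberwise (s := Finset.univ) (g := f.rangeRestrict), Finset.mul_sum]
  refine Finset.sum_congr rfl fun y _ => ?_
  rw [Finset.sum_congr rfl fun x hx => by rw [(Finset.mem_filter.mp hx).2], Finset.sum_const,
    nsmul_eq_mul]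
  congr 2
  obtain ⟨x₀, rfl⟩ := f.rangeRestrict_surjective y
  rw [← Fintype.card_subtype, ← Nat.card_eq_fintype_card]
  refine Nat.card_congr ⟨fun x => ⟨x₀⁻¹ * x.1, ?_⟩, fun k => ⟨x₀ * k.1, ?_⟩, ?_, ?_⟩
  · have := congrArg Subtype.val x.2
    simp only [MonoidHom.coe_rangeRestrict] at this
    simp [MonoidHom.mem_ker, this]
  · have := MonoidHom.mem_ker.mp k.2
    ext
    simp [this]
  · intro x; simp
  · intro x; simp

variable {F : Type*} [Field F] [Fintype F] [DecidableEq F]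

local notation "χ" => quadraticChar F

lemma sum_eq_zero_add_sum_units {M : Type*} [AddCommMonoid M] (φ : F → M) :
    ∑ x : F, φ x = φ 0 + ∑ u : Fˣ, φ u := by
  rw [← Finset.add_sum_erase _ _ (Finset.mem_univ (0 : F))]
  congr 1
  symm
  exact Finset.sum_bij (fun u _ => (u : F)) (fun u _ => by simp) (fun u _ v _ h => Units.ext h)
    (fun b hb => ⟨Units.mk0 b (Finset.ne_of_mem_erase hb), by simp, rfl⟩) fun _ _ => rfl

/-- After `x ↦ -x` this is, up to the factor `χ (-1)`, the Jacobi sum of `χ` and `χ⁻¹ = χ`. -/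
lemma sum_quadraticChar_mul_add_one (hF : ringChar F ≠ 2) : ∑ x : F, χ x * χ (x + 1) = -1 := by
  have h := jacobiSum_nontrivial_inv (quadraticChar_ne_one hF)
  rw [(quadraticChar_isQuadratic F).inv, jacobiSum] at h
  have h1 : χ (-1) * χ (-1) = 1 := by rw [← map_mul]; simp
  calc ∑ x : F, χ x * χ (x + 1) = ∑ x : F, χ (-1) * (χ x * χ (1 - x)) := by
        refine Fintype.sum_equiv (Equiv.neg F) _ _ fun x => ?_
        rw [← mul_assoc, ← map_mul χ (-1), Equiv.neg_apply, neg_one_mul, neg_neg, sub_neg_eq_add,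
          add_comm 1]
    _ = _ := by rw [← Finset.mul_sum, h, mul_neg, h1]

lemma sum_quadraticChar_add_mul_add (hF : ringChar F ≠ 2) (a b : F) :
    ∑ k : F, χ (a + k) * χ (b + k) = if a = b then (Fintype.card F : ℤ) - 1 else -1 := by
  split_ifs with h
  · subst h
    calc ∑ k : F, χ (a + k) * χ (a + k) = ∑ k : F, if k = 0 then (0 : ℤ) else 1 := by
          refine Fintype.sum_equiv (Equiv.addLeft a) _ _ fun k => ?_
          change _ = if a + k = 0 then 0 else 1
          by_cases hk : a + k = 0
          · simp [hk]
          · rw [← pow_two, quadraticChar_sq_one hk, if_neg hk]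
      _ = _ := by
          rw [sum_eq_zero_add_sum_units]
          simp [Fintype.card_units, Nat.cast_sub Fintype.card_pos]
  · have hc : b - a ≠ 0 := fun h' => h (sub_eq_zero.mp h').symm
    rw [← sum_quadraticChar_mul_add_one hF]
    refine Fintype.sum_equiv ((Equiv.addLeft a).trans (Equiv.mulRight₀ (b - a)⁻¹
      (inv_ne_zero hc))) _ _ fun k => ?_
    have e1 : (a + k) = (b - a) * ((a + k) * (b - a)⁻¹) := by field_simp
    have e2 : (b + k) = (b - a) * ((a + k) * (b - a)⁻¹ + 1) := by field_simp; ring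
    simp only [Equiv.trans_apply, Equiv.coe_addLeft, Equiv.mulRight₀_apply]
    generalize (a + k) * (b - a)⁻¹ = u at e1 e2 ⊢
    rw [e1, e2, map_mul, map_mul]
    have := quadraticChar_sq_one hc
    linear_combination (χ u * χ (u + 1)) * this

/-- The Jacobsthal-type sum `∑ χ (x (x ^ m + k))`. -/
def jacobsthalSum (m : ℕ) (k : F) : ℤ := ∑ x : F, χ x * χ (x ^ m + k)

lemma jacobsthalSum_zero (hF : ringChar F ≠ 2) {m : ℕ} (hm : Even m) (hm0 : m ≠ 0) :
    jacobsthalSum m (0 : F) = 0 := by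
  rw [jacobsthalSum, ← quadraticChar_sum_zero hF]
  refine Finset.sum_congr rfl fun x _ => ?_
  obtain ⟨r, rfl⟩ := hm
  by_cases hx : x = 0
  · simp [hx]
  · rw [add_zero, ← two_mul, mul_comm 2 r, pow_mul, quadraticChar_sq_one' (pow_ne_zero _ hx),
      mul_one]

lemma jacobsthalSum_mul_pow {m : ℕ} (hm : Even m) (k : F) {t : F} (ht : t ≠ 0) :
    jacobsthalSum m (k * t ^ m) = χ t * jacobsthalSum m k := by
  rw [jacobsthalSum, jacobsthalSum, Finset.mul_sum]
  symm
  refine Fintype.sum_equiv (Equiv.mulLeft₀ t ht) _ _ fun x => ?_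
  have hs : χ (t ^ m) = 1 := by
    obtain ⟨r, rfl⟩ := hm
    rw [← two_mul, mul_comm 2 r, pow_mul, quadraticChar_sq_one' (pow_ne_zero _ ht)]
  rw [Equiv.mulLeft₀_apply, mul_pow, mul_comm k, ← mul_add, map_mul, map_mul, hs]
  ring

lemma jacobsthalSum_eq_mul_inv {m : ℕ} (hm : Even m) {k : F} (hk : k ≠ 0) :
    jacobsthalSum m k = χ k * jacobsthalSum m k⁻¹ := by
  rw [jacobsthalSum, jacobsthalSum, Finset.mul_sum]
  refine Fintype.sum_equiv (Equiv.inv F) _ _ fun x => ?_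
  simp only [Equiv.inv_apply]
  by_cases hx : x = 0
  · simp [hx]
  obtain ⟨r, rfl⟩ := hm
  have h1 : x ^ (r + r) + k = (x ^ r) ^ 2 * k * (x⁻¹ ^ (r + r) + k⁻¹) := by
    rw [inv_pow]
    field_simp
    ring
  have h2 : χ x = χ x⁻¹ := by
    conv_lhs => rw [show x = x⁻¹ * x ^ 2 by field_simp]
    rw [map_mul, quadraticChar_sq_one' hx, mul_one]
  rw [h1, map_mul, map_mul, quadraticChar_sq_one' (pow_ne_zero _ hx), h2]
  ring

/-- Euler's criterion: `m` divides `(q - 1) / 2`, where `q` is the order of `F`. -/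
lemma quadraticChar_eq_one_of_pow_eq_one {m : ℕ} (hm : 2 * m ∣ Fintype.card F - 1) {x : F}
    (hx : x ^ m = 1) (hm0 : m ≠ 0) (hF : ringChar F ≠ 2) : χ x = 1 := by
  have hx0 : x ≠ 0 := by rintro rfl; simp [hm0] at hx
  obtain ⟨t, ht⟩ := hm
  have hpos := Fintype.one_lt_card (α := F)
  have : Fintype.card F / 2 = m * t := by
    have : Fintype.card F = 2 * (m * t) + 1 := by rw [← mul_assoc]; omega
    omega
  rw [quadraticChar_eq_pow_of_char_ne_two hF hx0, this, pow_mul, hx, one_pow, if_pos rfl]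

lemma card_pow_eq_one {m : ℕ} (hm : m ∣ Fintype.card F - 1) (hm0 : m ≠ 0) :
    (Finset.univ.filter fun x : F => x ^ m = 1).card = m := by
  have h := IsCyclic.card_powMonoidHom_ker (G := Fˣ) m
  rw [Nat.card_eq_fintype_card (α := Fˣ), Fintype.card_units, Nat.gcd_eq_right hm] at h
  rw [← Fintype.card_subtype, ← Nat.card_eq_fintype_card]
  refine Eq.trans ?_ h
  refine Nat.card_congr ⟨fun x => ⟨Units.mk0 x.1 ?_, ?_⟩, fun x => ⟨x.1, ?_⟩, ?_, ?_⟩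
  · intro h0
    have := x.2
    simp [h0, hm0] at this
  · ext; simp [x.2]
  · have := congrArg Units.val (MonoidHom.mem_ker.mp x.2)
    simpa using this
  · intro x; simp
  · intro x; simp

/-- Expand the square and sum over `k` first. The constant `-1` drops out because `∑ χ = 0`; the
diagonal `x ^ m = y ^ m` means `y = x * ζ` with `ζ ^ m = 1`, where `χ ζ = 1`. -/
lemma sum_sq_jacobsthalSum (hF : ringChar F ≠ 2) {m : ℕ} (hm : 2 * m ∣ Fintype.card F - 1)
    (hm0 : m ≠ 0) :
    ∑ k : F, jacobsthalSum m k ^ 2 = Fintype.card F * m * (Fintype.card F - 1 : ℤ) := by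
  have hinner (x : F) : ∑ y : F, (if x ^ m = y ^ m then χ x * χ y else 0) =
      if x = 0 then 0 else (m : ℤ) := by
    split_ifs with hx
    · simp [hx]
    calc _ = ∑ y : F, (if y ^ m = 1 then (1 : ℤ) else 0) := by
          symm
          refine Fintype.sum_equiv (Equiv.mulLeft₀ x hx) _ _ fun y => ?_
          rw [Equiv.mulLeft₀_apply, mul_pow]
          have : x ^ m = x ^ m * y ^ m ↔ y ^ m = 1 := by
            rw [left_eq_mul₀ (pow_ne_zero _ hx)]
          simp only [this]
          split_ifs with hy
          · rw [map_mul, quadraticChar_eq_one_of_pow_eq_one hm hy hm0 hF, mul_one, ← pow_two,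
              quadraticChar_sq_one hx]
          · rfl
      _ = _ := by
          rw [Finset.sum_boole, card_pow_eq_one ((Dvd.intro_left 2 rfl).trans hm) hm0]
  calc ∑ k : F, jacobsthalSum m k ^ 2
      = ∑ k : F, ∑ x : F, ∑ y : F, (χ x * χ y) * (χ (x ^ m + k) * χ (y ^ m + k)) := by
        refine Finset.sum_congr rfl fun k _ => ?_
        rw [pow_two, jacobsthalSum, Finset.sum_mul_sum]
        refine Finset.sum_congr rfl fun x _ => Finset.sum_congr rfl fun y _ => by ring
    _ = ∑ x : F, ∑ y : F, (χ x * χ y) * ∑ k : F, χ (x ^ m + k) * χ (y ^ m + k) := by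
        simp_rw [Finset.mul_sum]
        rw [Finset.sum_comm]
        refine Finset.sum_congr rfl fun x _ => Finset.sum_comm
    _ = ∑ x : F, ∑ y : F, ((Fintype.card F : ℤ) * (if x ^ m = y ^ m then χ x * χ y else 0) -
          χ x * χ y) := by
        refine Finset.sum_congr rfl fun x _ => Finset.sum_congr rfl fun y _ => ?_
        rw [sum_quadraticChar_add_mul_add hF]
        split_ifs <;> ring
    _ = _ := by
        simp_rw [Finset.sum_sub_distrib, ← Finset.mul_sum, hinner, quadraticChar_sum_zero hF]
        rw [sum_eq_zero_add_sum_units]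
        simp [Fintype.card_units, Nat.cast_sub Fintype.card_pos]
        ring

lemma Finset.sum_range_mul_of_periodic {M : Type*} [CommRing M] {ψ : ℕ → M} {m : ℕ}
    (h : ∀ i, ψ (i + m) = ψ i) (q : ℕ) :
    ∑ i ∈ Finset.range (q * m), ψ i = q * ∑ i ∈ Finset.range m, ψ i := by
  have hq (q i : ℕ) : ψ (q * m + i) = ψ i := by
    induction q with
    | zero => simp
    | succ q ih => rw [← ih, ← h (q * m + i)]; congr 1; ring
  induction q with
  | zero => simp
  | succ q ih =>
    rw [add_mul, one_mul, Finset.sum_range_add, ih, Finset.sum_congr rfl fun i _ => hq q i]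
    push_cast; ring

/-- The sum of the squares of the sums `∑ χ (x (x ^ m + g ^ b))` over the classes modulo
`m`-th powers. -/
lemma sum_range_sq_jacobsthalSum (hF : ringChar F ≠ 2) {m : ℕ}
    (hm : 2 * m ∣ Fintype.card F - 1) (hm0 : m ≠ 0) (hme : Even m) {g : Fˣ}
    (hg : ∀ x, x ∈ Subgroup.zpowers g) :
    ∑ b ∈ Finset.range m, jacobsthalSum m ((g : F) ^ b) ^ 2 = Fintype.card F * (m : ℤ) ^ 2 := by
  obtain ⟨q, hq⟩ := (Dvd.intro_left 2 rfl).trans hm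
  have hpos := Fintype.one_lt_card (α := F)
  have hord : orderOf g = q * m := by
    rw [orderOf_eq_card_of_forall_mem_zpowers hg, Nat.card_eq_fintype_card, Fintype.card_units,
      hq, mul_comm]
  have hq0 : (q : ℤ) ≠ 0 := by
    rintro h
    simp only [Nat.cast_eq_zero] at h
    simp [h] at hq
    omega
  have hcard : (Fintype.card F : ℤ) - 1 = m * q := by
    have : Fintype.card F = m * q + 1 := by omega
    rw [this]; push_cast; ring
  have h1 : ∑ k : F, jacobsthalSum m k ^ 2 = ∑ u : Fˣ, jacobsthalSum m (u : F) ^ 2 := by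
    rw [sum_eq_zero_add_sum_units, jacobsthalSum_zero hF hme hm0, zero_pow two_ne_zero, zero_add]
  have h2 : ∑ u : Fˣ, jacobsthalSum m (u : F) ^ 2 =
      ∑ i ∈ Finset.range (q * m), jacobsthalSum m ((g : F) ^ i) ^ 2 := by
    classical
    rw [← hord, ← IsCyclic.image_range_orderOf hg, Finset.sum_image]
    · simp
    · intro i hi j hj h
      exact pow_injOn_Iio_orderOf (by simpa using hi) (by simpa using hj) h
  -- Multiplying the argument by `g ^ m` only changes the sign, so the squares are `m`-periodic in
  -- the exponent.
  have h3 : ∑ i ∈ Finset.range (q * m), jacobsthalSum m ((g : F) ^ i) ^ 2 =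
      q * ∑ b ∈ Finset.range m, jacobsthalSum m ((g : F) ^ b) ^ 2 := by
    refine Finset.sum_range_mul_of_periodic (fun i => ?_) q
    rw [pow_add, jacobsthalSum_mul_pow hme _ (Units.ne_zero g), mul_pow,
      quadraticChar_sq_one (Units.ne_zero g), one_mul]
  have h4 := sum_sq_jacobsthalSum hF hm hm0
  rw [h1, h2, h3, hcard] at h4
  apply mul_left_cancel₀ hq0
  rw [h4]; ring

/-- `χ` is trivial on the `m`-th roots of unity, so it factors through `x ↦ x ^ m`. -/
lemma exists_char_pow_eq_quadraticChar (hF : ringChar F ≠ 2) {m : ℕ}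
    (hm : 2 * m ∣ Fintype.card F - 1) (hm0 : m ≠ 0) :
    ∃ η : (powMonoidHom m : Fˣ →* Fˣ).range →* ℤˣ,
      ∀ x : Fˣ, (η ((powMonoidHom m).rangeRestrict x) : ℤ) = χ x := by
  let f := (powMonoidHom m : Fˣ →* Fˣ).rangeRestrict
  have hk : f.ker ≤ (χ).toUnitHom.ker := by
    intro x hx
    rw [MonoidHom.ker_rangeRestrict, MonoidHom.mem_ker] at hx
    rw [MonoidHom.mem_ker]
    ext
    rw [MulChar.coe_toUnitHom]
    exact quadraticChar_eq_one_of_pow_eq_one hm (by simpa using congrArg Units.val hx) hm0 hF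
  refine ⟨f.liftOfSurjective (MonoidHom.rangeRestrict_surjective _) ⟨_, hk⟩, fun x => ?_⟩
  rw [← MulChar.coe_toUnitHom]
  congr 1
  exact f.liftOfRightInverse_comp_apply _ _ ⟨_, hk⟩ x

lemma card_ker_powMonoidHom_units {m : ℕ} (hm : m ∣ Fintype.card F - 1) :
    Nat.card (powMonoidHom m : Fˣ →* Fˣ).ker = m := by
  rw [IsCyclic.card_powMonoidHom_ker, Nat.card_eq_fintype_card, Fintype.card_units,
    Nat.gcd_eq_right hm]

lemma jacobsthalSum_eq_mul_sum_range {m : ℕ} (hm : m ∣ Fintype.card F - 1)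
    {η : (powMonoidHom m : Fˣ →* Fˣ).range →* ℤˣ}
    (hη : ∀ x : Fˣ, (η ((powMonoidHom m).rangeRestrict x) : ℤ) = χ x) (k : F) :
    jacobsthalSum m k =
      m * ∑ h : (powMonoidHom m : Fˣ →* Fˣ).range, (η h : ℤ) * χ ((h : Fˣ) + k) := by
  have := (powMonoidHom m : Fˣ →* Fˣ).sum_comp_eq_card_ker_mul
    (fun h => (η h : ℤ) * χ ((h : Fˣ) + k))
  rw [card_ker_powMonoidHom_units hm] at this
  rw [← this, jacobsthalSum, sum_eq_zero_add_sum_units]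
  simp [hη]

end CharacterSums

/-! ### Evaluating the two real character sums -/

section FourthPowers

/-- A prime has at most one representation `a ^ 2 + d * b ^ 2` up to signs when `2 ≤ d`. -/
lemma Nat.Prime.sq_eq_sq_of_eq_sq_add_mul_sq {p : ℕ} (hp : p.Prime) {d a b x y : ℤ} (hd : 2 ≤ d)
    (h₁ : (p : ℤ) = a ^ 2 + d * b ^ 2) (h₂ : (p : ℤ) = x ^ 2 + d * y ^ 2) : a ^ 2 = x ^ 2 := by
  have hp0 : (p : ℤ) ≠ 0 := by exact_mod_cast hp.ne_zero
  have key (y : ℤ) (h₂ : (p : ℤ) = x ^ 2 + d * y ^ 2) (h : (p : ℤ) ∣ a * y - b * x) :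
      a ^ 2 = x ^ 2 := by
    obtain ⟨c, hc⟩ := h
    have e1 : (p : ℤ) ^ 2 = (a * x + d * b * y) ^ 2 + d * (a * y - b * x) ^ 2 := by
      rw [pow_two (p : ℤ)]; nth_rewrite 1 [h₁]; rw [h₂]; ring
    -- Otherwise `d * c ^ 2 ≥ 2` makes the right side of Brahmagupta's identity `e1` at least `2 * p
    -- ^ 2`.
    have hc0 : c = 0 := by
      by_contra hc0
      have h1 : 1 ≤ c ^ 2 := by have := sq_pos_of_ne_zero hc0; omega
      have hpp : 0 < (p : ℤ) ^ 2 := by positivity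
      rw [hc, mul_pow] at e1
      nlinarith [sq_nonneg (a * x + d * b * y), mul_le_mul hd h1 zero_le_one (by omega),
        mul_nonneg hpp.le (show 0 ≤ d * c ^ 2 - 2 by nlinarith)]
    rw [hc0, mul_zero, sub_eq_zero] at hc
    have e2 : (p : ℤ) * (y ^ 2 - b ^ 2) = 0 := by
      have : (a * y) ^ 2 = (b * x) ^ 2 := by rw [hc]
      calc (p : ℤ) * (y ^ 2 - b ^ 2) = p * y ^ 2 - p * b ^ 2 := by ring
        _ = (a ^ 2 + d * b ^ 2) * y ^ 2 - (x ^ 2 + d * y ^ 2) * b ^ 2 := by rw [← h₁, ← h₂]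
        _ = (a * y) ^ 2 - (b * x) ^ 2 := by ring
        _ = 0 := by rw [this, sub_self]
    have e3 : y ^ 2 = b ^ 2 := by
      rcases _root_.mul_eq_zero.mp e2 with h | h
      · exact absurd h hp0
      · linarith
    rw [e3] at h₂
    linarith
  have hdvd : (p : ℤ) ∣ (a * y - b * x) * (a * y + b * x) := by
    refine ⟨y ^ 2 - b ^ 2, ?_⟩
    calc (a * y - b * x) * (a * y + b * x)
        = (a ^ 2 + d * b ^ 2) * y ^ 2 - (x ^ 2 + d * y ^ 2) * b ^ 2 := by ring
      _ = _ := by rw [← h₁, ← h₂]; ring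
  rcases (Nat.prime_iff_prime_int.mp hp).dvd_or_dvd hdvd with h | h
  · exact key y h₂ h
  · refine key (-y) (by rw [neg_sq]; exact h₂) ?_
    have : a * -y - b * x = -(a * y + b * x) := by ring
    rwa [this, dvd_neg]

lemma eq_one_or_eq_neg_one_of_inv_eq {F : Type*} [Field F] {H : Subgroup Fˣ} {h : H} (hh : h⁻¹ = h) :
    h = 1 ∨ ((h : Fˣ) : F) = -1 := by
  have h1 : ((h : Fˣ) : F) ^ 2 = 1 := by
    have : h * h = 1 := by nth_rewrite 1 [← hh]; exact inv_mul_cancel h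
    rw [pow_two]
    exact congrArg (fun x : H => ((x : Fˣ) : F)) this
  rcases sq_eq_one_iff.mp h1 with h | h
  · exact Or.inl (by ext; exact h)
  · exact Or.inr h

variable {F : Type*} [Field F] [Fintype F] [DecidableEq F]

local notation "χ" => quadraticChar F

/-- The second moment for `m = 2` has two terms, at `1` and at a generator, each the square of an
even number. -/
lemma exists_jacobsthalSum_two_eq (hF : ringChar F ≠ 2) (hc : 4 ∣ Fintype.card F - 1) :
    ∃ A B : ℤ, jacobsthalSum 2 (1 : F) = 2 * A ∧ (Fintype.card F : ℤ) = A ^ 2 + B ^ 2 := by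
  obtain ⟨η, hη⟩ := exists_char_pow_eq_quadraticChar (m := 2) hF hc two_ne_zero
  obtain ⟨g, hg⟩ := IsCyclic.exists_generator (α := Fˣ)
  have h2 := jacobsthalSum_eq_mul_sum_range ((Dvd.intro_left 2 rfl).trans hc) hη
  have h := sum_range_sq_jacobsthalSum hF hc two_ne_zero even_two hg
  simp only [Finset.sum_range_succ, Finset.sum_range_zero, pow_zero, pow_one, zero_add] at h
  refine ⟨_, ∑ h : (powMonoidHom 2 : Fˣ →* Fˣ).range, (η h : ℤ) * χ ((h : Fˣ) + (g : F)),
    h2 1, ?_⟩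
  rw [h2 1, h2 g] at h
  push_cast at h
  linarith

lemma quadraticChar_generator (hF : ringChar F ≠ 2) {g : Fˣ}
    (hg : ∀ x, x ∈ Subgroup.zpowers g) : χ (g : F) = -1 := by
  obtain ⟨a, ha⟩ := quadraticChar_exists_neg_one' hF
  refine (quadraticChar_dichotomy (Units.ne_zero g)).resolve_left fun h => ?_
  obtain ⟨k, rfl⟩ := Subgroup.mem_zpowers_iff.mp (hg a)
  have : (χ).toUnitHom g = 1 := by ext; rw [MulChar.coe_toUnitHom, h]; rfl
  rw [← MulChar.coe_toUnitHom, map_zpow, this, one_zpow] at ha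
  exact absurd ha (by decide)

/-- Of the four terms of the second moment for `m = 4`, the one at `g ^ 2` vanishes and those at `g`
and `g ^ 3` coincide, whence the coefficient 2. -/
lemma card_eq_sq_add_two_mul_sq (hF : ringChar F ≠ 2) (hc : 8 ∣ Fintype.card F - 1)
    {η : (powMonoidHom 4 : Fˣ →* Fˣ).range →* ℤˣ}
    (hη : ∀ x : Fˣ, (η ((powMonoidHom 4).rangeRestrict x) : ℤ) = χ x) :
    ∃ B : ℤ, (Fintype.card F : ℤ) =
      (∑ h : (powMonoidHom 4 : Fˣ →* Fˣ).range, (η h : ℤ) * χ ((h : Fˣ) + 1)) ^ 2 + 2 * B ^ 2 := by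
  obtain ⟨g, hg⟩ := IsCyclic.exists_generator (α := Fˣ)
  have h4 : Even 4 := by decide
  have h2 := jacobsthalSum_eq_mul_sum_range ((Dvd.intro_left 2 rfl).trans hc) hη
  have h := sum_range_sq_jacobsthalSum hF hc four_ne_zero h4 hg
  have hg0 : (g : F) ≠ 0 := Units.ne_zero g
  have hχ := quadraticChar_generator hF hg
  -- Inversion sends `g ^ 2` to `g ^ 2 * g⁻¹ ^ 4`, so the sum equals its own negative.
  have e2 : jacobsthalSum 4 ((g : F) ^ 2) = 0 := by
    have h5 := jacobsthalSum_eq_mul_inv h4 (pow_ne_zero 2 hg0)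
    rw [quadraticChar_sq_one' hg0, one_mul,
      show ((g : F) ^ 2)⁻¹ = g ^ 2 * (g : F)⁻¹ ^ 4 by field_simp,
      jacobsthalSum_mul_pow h4 _ (inv_ne_zero hg0), ← Ring.inverse_eq_inv',
      ← MulChar.inv_apply, (quadraticChar_isQuadratic F).inv, hχ] at h5
    linarith
  have e3 : jacobsthalSum 4 ((g : F) ^ 3) ^ 2 = jacobsthalSum 4 (g : F) ^ 2 := by
    rw [jacobsthalSum_eq_mul_inv h4 (pow_ne_zero 3 hg0),
      show ((g : F) ^ 3)⁻¹ = g * (g : F)⁻¹ ^ 4 by field_simp,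
      jacobsthalSum_mul_pow h4 _ (inv_ne_zero hg0), mul_pow, mul_pow,
      quadraticChar_sq_one (pow_ne_zero 3 hg0), quadraticChar_sq_one (inv_ne_zero hg0),
      one_mul, one_mul]
  simp only [Finset.sum_range_succ, Finset.sum_range_zero, pow_zero, pow_one, zero_add, e2, e3] at h
  refine ⟨∑ h : (powMonoidHom 4 : Fˣ →* Fˣ).range, (η h : ℤ) * χ ((h : Fˣ) + (g : F)), ?_⟩
  rw [h2 1, h2 g] at h
  push_cast at h
  linarith

lemma sum_comp_sq (hF : ringChar F ≠ 2) (φ : F → ℤ) :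
    ∑ x : F, φ (x ^ 2) = ∑ y : F, (1 + χ y) * φ y := by
  rw [← Finset.sum_fiberwise (s := Finset.univ) (g := fun x : F => x ^ 2)]
  refine Finset.sum_congr rfl fun y _ => ?_
  rw [Finset.sum_congr rfl fun x hx => by rw [(Finset.mem_filter.mp hx).2], Finset.sum_const,
    nsmul_eq_mul, add_comm 1, ← quadraticChar_card_sqrts hF]
  congr 2
  congr 1
  ext x
  simp

/-- Write `x ^ 4 = (x ^ 2) ^ 2` and replace a sum over squares by one weighted with `1 + χ y`,
twice. -/
lemma four_mul_sum_range_powMonoidHom_four (hF : ringChar F ≠ 2) (hc : 4 ∣ Fintype.card F - 1) :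
    4 * ∑ h : (powMonoidHom 4 : Fˣ →* Fˣ).range, χ ((h : Fˣ) + 1) =
      jacobsthalSum 2 (1 : F) - 2 := by
  have h1 := (powMonoidHom 4 : Fˣ →* Fˣ).sum_comp_eq_card_ker_mul fun h => χ ((h : Fˣ) + 1)
  rw [card_ker_powMonoidHom_units hc] at h1
  have h2 : ∑ x : F, χ (x ^ 4 + 1) = -1 + jacobsthalSum 2 (1 : F) := by
    calc ∑ x : F, χ (x ^ 4 + 1) = ∑ x : F, χ ((x ^ 2) ^ 2 + 1) := by
          simp only [← pow_mul]
      _ = ∑ y : F, (χ (y ^ 2 + 1) + χ y * χ (y ^ 2 + 1)) := by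
          rw [sum_comp_sq hF fun z => χ (z ^ 2 + 1)]
          simp only [add_mul, one_mul]
      _ = ∑ z : F, (χ (z + 1) + χ z * χ (z + 1)) + jacobsthalSum 2 (1 : F) := by
          rw [Finset.sum_add_distrib, sum_comp_sq hF fun z => χ (z + 1)]
          simp only [add_mul, one_mul]
          rfl
      _ = _ := by
          rw [Finset.sum_add_distrib, sum_quadraticChar_mul_add_one hF,
            Fintype.sum_equiv (Equiv.addRight (1 : F)) (fun x => χ (x + 1)) χ fun x => rfl,
            quadraticChar_sum_zero hF]
          ring
  rw [sum_eq_zero_add_sum_units] at h2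
  have h3 : ∑ u : Fˣ, χ ((u : F) ^ 4 + 1) =
      4 * ∑ h : (powMonoidHom 4 : Fˣ →* Fˣ).range, χ ((h : Fˣ) + 1) := by
    push_cast at h1
    rw [← h1]
    simp
  rw [← h3]
  simp only [ne_eq, OfNat.ofNat_ne_zero, not_false_eq_true, zero_pow, zero_add, map_one] at h2
  linarith

lemma quadraticChar_pow_four (u : Fˣ) : χ ((u : F) ^ 4) = 1 := by
  rw [show (u : F) ^ 4 = (u ^ 2) ^ 2 by ring,
    quadraticChar_sq_one' (pow_ne_zero 2 (Units.ne_zero u))]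

lemma quadraticChar_of_mem_range {h : Fˣ} (hh : h ∈ (powMonoidHom 4 : Fˣ →* Fˣ).range) :
    χ (h : F) = 1 := by
  obtain ⟨u, rfl⟩ := hh
  simpa using quadraticChar_pow_four u

lemma quadraticChar_inv_add_one (h : (powMonoidHom 4 : Fˣ →* Fˣ).range) :
    χ (((h⁻¹ : (powMonoidHom 4 : Fˣ →* Fˣ).range) : Fˣ) + 1) = χ ((h : Fˣ) + 1) := by
  have h0 : ((h : Fˣ) : F) ≠ 0 := Units.ne_zero _
  have : ((h : Fˣ) : F) + 1 = (h : Fˣ) * (((h⁻¹ : (powMonoidHom 4 : Fˣ →* Fˣ).range) : Fˣ) + 1) := by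
    simp [mul_add, add_comm]
  rw [this, map_mul, quadraticChar_of_mem_range h.2, one_mul]

/-- Terms at `h` and `h⁻¹` agree and cancel modulo 2. The fixed point 1 gives `χ 2 = ±1`; `-1`, if
present, gives 0. -/
lemma odd_sum_range_powMonoidHom_four (hF : ringChar F ≠ 2) :
    Odd (∑ h : (powMonoidHom 4 : Fˣ →* Fˣ).range, χ ((h : Fˣ) + 1)) := by
  have h2 : (2 : F) ≠ 0 := Ring.two_ne_zero hF
  have h1 : ∑ h ∈ Finset.univ.erase (1 : (powMonoidHom 4 : Fˣ →* Fˣ).range),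
      ((χ ((h : Fˣ) + 1) : ℤ) : ZMod 2) = 0 := by
    refine Finset.sum_involution (fun h _ => h⁻¹) (fun h _ => ?_) (fun h hh hne heq => hne ?_)
      (fun h hh => ?_) fun h _ => inv_inv h
    · rw [quadraticChar_inv_add_one]; exact CharTwo.add_self_eq_zero _
    · rcases eq_one_or_eq_neg_one_of_inv_eq heq with h | h
      · exact absurd h (Finset.ne_of_mem_erase hh)
      · simp [h]
    · simpa using hh
  rw [← Int.not_even_iff_odd, ← ZMod.intCast_eq_zero_iff_even,
    ← Finset.add_sum_erase _ _ (Finset.mem_univ 1), Int.cast_add, Int.cast_sum, h1, add_zero]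
  have : χ (((1 : (powMonoidHom 4 : Fˣ →* Fˣ).range) : Fˣ) + 1) = χ 2 := by
    congr 1; simp; norm_num
  rw [this]
  rcases quadraticChar_dichotomy h2 with h | h <;> rw [h] <;> decide

/-- Away from `±1`, terms at `h` and `h⁻¹` are equal signs, and twice a sign is 2 modulo 4, so each
term may be replaced by 1. With `n = (q - 1) / 8` there are `2n - 2` of these; `h = 1` adds 1 and `h
= -1` adds 0. -/
lemma sum_mul_quadraticChar_modEq (hF : ringChar F ≠ 2) (hc : 8 ∣ Fintype.card F - 1)
    (hχ2 : χ 2 = 1) (η : (powMonoidHom 4 : Fˣ →* Fˣ).range →* ℤˣ) :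
    ∑ h : (powMonoidHom 4 : Fˣ →* Fˣ).range, (η h : ℤ) * χ ((h : Fˣ) + 1) ≡
      2 * ((Fintype.card F - 1) / 8 : ℕ) - 1 [ZMOD 4] := by
  let G := (powMonoidHom 4 : Fˣ →* Fˣ).range
  let n := (Fintype.card F - 1) / 8
  have hn : Fintype.card F - 1 = 8 * n := (Nat.mul_div_cancel' hc).symm
  have hcard : Fintype.card G = 2 * n := by
    rw [← Nat.card_eq_fintype_card, IsCyclic.card_powMonoidHom_range, Nat.card_eq_fintype_card,
      Fintype.card_units, Nat.gcd_eq_right ((Dvd.intro_left 2 rfl).trans hc), hn]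
    omega
  have hF1 := Fintype.one_lt_card (α := F)
  obtain ⟨u, hu⟩ : ∃ u : G, ((u : Fˣ) : F) = -1 := by
    -- For a generator `g` of order `8n`, `-1 = (g ^ n) ^ 4`.
    obtain ⟨g, hg⟩ := IsCyclic.exists_generator (α := Fˣ)
    have hord : orderOf g = 8 * n := by
      rw [orderOf_eq_card_of_forall_mem_zpowers hg, Nat.card_eq_fintype_card, Fintype.card_units, hn]
    refine ⟨(powMonoidHom 4).rangeRestrict (g ^ n), ?_⟩
    have h1 : ((g : F) ^ (4 * n)) ^ 2 = 1 := by
      rw [← pow_mul, show 4 * n * 2 = 8 * n by ring, ← hord, ← Units.val_pow_eq_pow_val,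
        pow_orderOf_eq_one, Units.val_one]
    rcases sq_eq_one_iff.mp h1 with h | h
    · exfalso
      have : orderOf g ∣ 4 * n := orderOf_dvd_of_pow_eq_one (by ext; simpa using h)
      have := Nat.le_of_dvd (by omega) this
      omega
    · simp [← pow_mul, h]
  have hu1 : u ≠ 1 := by
    rintro rfl
    exact Ring.neg_one_ne_one_of_char_ne_two hF (by simpa using hu.symm)
  have key : ∑ h ∈ (Finset.univ.erase (1 : G)).erase u,
      (((η h : ℤ) * χ ((h : Fˣ) + 1) : ℤ) - 1 : ZMod 4) = 0 := by
    refine Finset.sum_involution (fun h _ => h⁻¹) (fun h hh => ?_) (fun h hh _ heq => ?_)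
      (fun h hh => ?_) fun h _ => inv_inv h
    · have hη : η h⁻¹ = η h := by
        rw [map_inv]; exact Int.units_inv_eq_self _
      rw [quadraticChar_inv_add_one, hη]
      have h0 : ((h : Fˣ) : F) + 1 ≠ 0 := by
        intro h0
        refine Finset.ne_of_mem_erase hh ?_
        ext
        rw [hu]
        exact eq_neg_of_add_eq_zero_left h0
      rcases Int.units_eq_one_or (η h) with h1 | h1 <;>
        rcases quadraticChar_dichotomy h0 with h2 | h2 <;> rw [h1, h2] <;> decide
    · rcases eq_one_or_eq_neg_one_of_inv_eq heq with h | h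
      · simp [h] at hh
      · refine Finset.ne_of_mem_erase hh ?_
        ext
        rw [hu, h]
    · have hui : u⁻¹ = u := by
        ext; simp [hu, inv_neg]
      have : h ≠ u ∧ h ≠ 1 := by simpa using hh
      refine Finset.mem_erase.mpr ⟨fun h' => this.1 ?_, Finset.mem_erase.mpr ⟨?_, by simp⟩⟩
      · rw [← inv_inv h, h', hui]
      · simpa using this.2
  have hmem : u ∈ Finset.univ.erase (1 : G) := by simp [hu1]
  rw [Finset.sum_sub_distrib, Finset.sum_const, Finset.card_erase_of_mem hmem,
    Finset.card_erase_of_mem (Finset.mem_univ _), Finset.card_univ, hcard, ← Int.cast_sum,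
    sub_eq_zero] at key
  have hn0 : 1 ≤ n := by omega
  have h1 : (η 1 : ℤ) * χ (((1 : G) : Fˣ) + 1) = 1 := by
    have : (((1 : G) : Fˣ) : F) + 1 = 2 := by simp; norm_num
    rw [this, hχ2]; simp
  have hu' : (η u : ℤ) * χ ((u : Fˣ) + 1) = 0 := by rw [hu]; simp
  rw [← Finset.add_sum_erase _ _ (Finset.mem_univ (1 : G)), ← Finset.add_sum_erase _ _ hmem,
    h1, hu', zero_add]
  refine (ZMod.intCast_eq_intCast_iff _ _ 4).mp ?_
  rw [Int.cast_add, key]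
  change _ = (((2 * (n : ℤ) - 1 : ℤ)) : ZMod 4)
  obtain ⟨k, hk⟩ : ∃ k, n = k + 1 := ⟨n - 1, by omega⟩
  rw [hk, show 2 * (k + 1) - 1 - 1 = 2 * k by omega]
  push_cast
  simp
  ring

end FourthPowers

/-! ### The determinant as a group determinant -/

section BiquadraticDeterminant

lemma mem_biquadraticResidues {p : ℕ} {a : ℤ} :
    a ∈ biquadraticResidues p ↔ (0 < a ∧ a < p) ∧ ∃ b : ℤ, ((b : ZMod p)) ^ 4 = a := by
  simp [biquadraticResidues, ← ZMod.intCast_eq_intCast_iff]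

lemma biquadraticResidue_mem {p : ℕ} (i : Fin (biquadraticResidues p).card) :
    biquadraticResidue p i ∈ biquadraticResidues p :=
  Finset.orderEmbOfFin_mem _ _ _

variable {p : ℕ} [Fact p.Prime]

lemma intCast_ne_zero_of_mem_biquadraticResidues {a : ℤ} (ha : a ∈ biquadraticResidues p) :
    (a : ZMod p) ≠ 0 := by
  have h := (mem_biquadraticResidues.mp ha).1
  rw [Ne, ZMod.intCast_zmod_eq_zero_iff_dvd]
  exact fun hd => absurd (Int.le_of_dvd h.1 hd) (by omega)

/-- The biquadratic residues, enumerated in increasing order, as the group of fourth powers. -/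
noncomputable def biquadraticResidueEquiv (p : ℕ) [Fact p.Prime] :
    Fin (biquadraticResidues p).card ≃ (powMonoidHom 4 : (ZMod p)ˣ →* (ZMod p)ˣ).range :=
  Equiv.ofBijective (fun i => ⟨Units.mk0 _
      (intCast_ne_zero_of_mem_biquadraticResidues (biquadraticResidue_mem i)), by
    obtain ⟨b, hb⟩ := (mem_biquadraticResidues.mp (biquadraticResidue_mem i)).2
    refine ⟨Units.mk0 (b : ZMod p) fun h0 => ?_, by ext; simpa using hb⟩
    refine intCast_ne_zero_of_mem_biquadraticResidues (biquadraticResidue_mem i) ?_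
    rw [← hb, h0, zero_pow four_ne_zero]⟩) (by
    constructor
    · intro i j hij
      have h : ((biquadraticResidue p i : ℤ) : ZMod p) = biquadraticResidue p j :=
        congrArg (fun h : (powMonoidHom 4 : (ZMod p)ˣ →* (ZMod p)ˣ).range => ((h : (ZMod p)ˣ) : ZMod p)) hij
      have hi := (mem_biquadraticResidues.mp (biquadraticResidue_mem i)).1
      have hj := (mem_biquadraticResidues.mp (biquadraticResidue_mem j)).1
      rw [ZMod.intCast_eq_intCast_iff, Int.ModEq, Int.emod_eq_of_lt hi.1.le hi.2,
        Int.emod_eq_of_lt hj.1.le hj.2] at h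
      exact ((biquadraticResidues p).orderEmbOfFin rfl).injective h
    · rintro ⟨_, x, rfl⟩
      have hv : (((x ^ 4 : (ZMod p)ˣ) : ZMod p).val : ZMod p) = (x : ZMod p) ^ 4 := by simp
      have hm : (((x ^ 4 : (ZMod p)ˣ) : ZMod p).val : ℤ) ∈ biquadraticResidues p := by
        refine mem_biquadraticResidues.mpr ⟨⟨?_, by exact_mod_cast ZMod.val_lt _⟩,
          ((x : ZMod p).val : ℤ), by simp⟩
        have := (ZMod.val_ne_zero _).mpr (Units.ne_zero (x ^ 4))
        omega
      obtain ⟨i, hi⟩ : (((x ^ 4 : (ZMod p)ˣ) : ZMod p).val : ℤ) ∈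
          Set.range ((biquadraticResidues p).orderEmbOfFin rfl) := by
        rw [Finset.range_orderEmbOfFin]; exact hm
      refine ⟨i, ?_⟩
      ext
      simp only [biquadraticResidue, hi]
      simp)

lemma biquadraticResidueEquiv_apply (i : Fin (biquadraticResidues p).card) :
    ((biquadraticResidueEquiv p i : (ZMod p)ˣ) : ZMod p) = (biquadraticResidue p i : ℤ) := rfl

lemma biquadraticDet_eq_groupDet :
    biquadraticDet p = (Matrix.of fun a b : (powMonoidHom 4 : (ZMod p)ˣ →* (ZMod p)ˣ).range =>
      quadraticChar (ZMod p) (((a / b : (powMonoidHom 4 : (ZMod p)ˣ →* (ZMod p)ˣ).range) :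
        (ZMod p)ˣ) + 1)).det := by
  rw [← Matrix.det_submatrix_equiv_self (biquadraticResidueEquiv p), biquadraticDet]
  congr 1
  ext i j
  have h := quadraticChar_of_mem_range (biquadraticResidueEquiv p j).2
  have h0 := Units.ne_zero (biquadraticResidueEquiv p j : (ZMod p)ˣ)
  simp only [Matrix.of_apply, Matrix.submatrix_apply, legendreSym]
  rw [Int.cast_add, ← biquadraticResidueEquiv_apply, ← biquadraticResidueEquiv_apply]
  generalize biquadraticResidueEquiv p i = a at *
  generalize biquadraticResidueEquiv p j = b at *
  have e : ((a : (ZMod p)ˣ) : ZMod p) + (b : (ZMod p)ˣ) =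
      (b : (ZMod p)ˣ) * (((a / b : (powMonoidHom 4 : (ZMod p)ˣ →* (ZMod p)ˣ).range) :
        (ZMod p)ˣ) + 1) := by
    simp
    field_simp
  rw [e, map_mul, h, one_mul]

/-- Here `G` has odd order, so only the trivial character squares to 1. -/
lemma exists_biquadraticDet_eq_mul_sq (hp : p % 8 = 5) :
    ∃ z : ℤ, biquadraticDet p = (∑ h : (powMonoidHom 4 : (ZMod p)ˣ →* (ZMod p)ˣ).range,
      quadraticChar (ZMod p) ((h : (ZMod p)ˣ) + 1)) * z ^ 2 := by
  classical
  let G := (powMonoidHom 4 : (ZMod p)ˣ →* (ZMod p)ˣ).range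
  let L := AlgebraicClosure ℚ
  have := AlgebraicClosure.isGalois_rat
  have : NeZero (Monoid.exponent G) := ⟨Monoid.exponent_ne_zero_of_finite⟩
  have : Fintype (G →* Lˣ) := Fintype.ofFinite _
  obtain ⟨z, hz⟩ := exists_groupDet_eq_prod_mul_sq (G := G) L
    (f := fun h => quadraticChar (ZMod p) ((h : (ZMod p)ˣ) + 1)) quadraticChar_inv_add_one
  have hcard : Odd (Nat.card G) := by
    rw [IsCyclic.card_powMonoidHom_range, Nat.card_eq_fintype_card, ZMod.card_units,
      Nat.gcd_eq_right (by omega), Nat.odd_iff]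
    omega
  have huniv : (Finset.univ.filter fun ψ : G →* Lˣ => ψ ^ 2 = 1) = {1} := by
    ext ψ
    simp only [Finset.mem_filter, Finset.mem_univ, true_and, Finset.mem_singleton]
    refine ⟨fun h => ?_, fun h => by rw [h]; exact one_pow (M := G →* Lˣ) 2⟩
    obtain ⟨k, hk⟩ := hcard
    ext a
    have h1 : ψ a ^ 2 = 1 := DFunLike.congr_fun h a
    have h2 : ψ a ^ (2 * k + 1) = 1 := by rw [← hk, ← map_pow, pow_card_eq_one', map_one]
    rw [pow_succ, pow_mul, h1, one_pow, one_mul] at h2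
    rw [h2]; rfl
  refine ⟨z, ?_⟩
  rw [huniv, Finset.prod_singleton, ← biquadraticDet_eq_groupDet] at hz
  apply Int.cast_injective (α := L)
  rw [hz]
  simp [charSum, G, L]

/-- A character of the cyclic group `G` is determined by its value at `g ^ 4`. If it squares to 1
that value is `±1`, leaving only the trivial character and `η`. -/
lemma exists_biquadraticDet_eq_mul_mul_sq (hp : p % 8 = 1)
    {η : (powMonoidHom 4 : (ZMod p)ˣ →* (ZMod p)ˣ).range →* ℤˣ}
    (hη : ∀ x : (ZMod p)ˣ,
      (η ((powMonoidHom 4).rangeRestrict x) : ℤ) = quadraticChar (ZMod p) x) :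
    ∃ z : ℤ, biquadraticDet p = (∑ h : (powMonoidHom 4 : (ZMod p)ˣ →* (ZMod p)ˣ).range,
      quadraticChar (ZMod p) ((h : (ZMod p)ˣ) + 1)) *
      (∑ h : (powMonoidHom 4 : (ZMod p)ˣ →* (ZMod p)ˣ).range,
        (η h : ℤ) * quadraticChar (ZMod p) ((h : (ZMod p)ˣ) + 1)) * z ^ 2 := by
  classical
  let G := (powMonoidHom 4 : (ZMod p)ˣ →* (ZMod p)ˣ).range
  let L := AlgebraicClosure ℚ
  have := AlgebraicClosure.isGalois_rat
  have : NeZero (Monoid.exponent G) := ⟨Monoid.exponent_ne_zero_of_finite⟩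
  have : Fintype (G →* Lˣ) := Fintype.ofFinite _
  obtain ⟨z, hz⟩ := exists_groupDet_eq_prod_mul_sq (G := G) L
    (f := fun h => quadraticChar (ZMod p) ((h : (ZMod p)ˣ) + 1)) quadraticChar_inv_add_one
  obtain ⟨g, hg⟩ := IsCyclic.exists_generator (α := (ZMod p)ˣ)
  have hF : ringChar (ZMod p) ≠ 2 := by rw [ZMod.ringChar_zmod_n]; omega
  let r : (ZMod p)ˣ →* G := (powMonoidHom 4 : (ZMod p)ˣ →* (ZMod p)ˣ).rangeRestrict
  have hr : Function.Surjective r := MonoidHom.rangeRestrict_surjective _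
  have hηg : η (r g) = -1 := by
    ext
    exact (hη g).trans (quadraticChar_generator hF hg)
  let ηL : G →* Lˣ := (Units.map (Int.castRingHom L : ℤ →* L)).comp η
  have hηLg : ηL (r g) = -1 := by
    ext
    simp [ηL, hηg]
  have hext {ψ φ : G →* Lˣ} (h : ψ (r g) = φ (r g)) : ψ = φ := by
    have := (MonoidHom.eq_iff_eq_on_generator hg (ψ.comp r) (φ.comp r)).mpr h
    exact (MonoidHom.cancel_right hr).mp this
  have hne : (1 : G →* Lˣ) ≠ ηL := by
    intro h
    have := (DFunLike.congr_fun h (r g)).trans hηLg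
    have := congrArg Units.val this
    norm_num at this
  have huniv : (Finset.univ.filter fun ψ : G →* Lˣ => ψ ^ 2 = 1) = {1, ηL} := by
    ext ψ
    simp only [Finset.mem_filter, Finset.mem_univ, true_and, Finset.mem_singleton,
      Finset.mem_insert]
    constructor
    · intro h
      have h1 : ((ψ (r g) : Lˣ) : L) ^ 2 = 1 := by
        have : ψ (r g) ^ 2 = 1 := DFunLike.congr_fun h (r g)
        exact congrArg Units.val this
      rcases sq_eq_one_iff.mp h1 with h2 | h2
      · exact Or.inl (hext (by ext; simpa using h2))
      · exact Or.inr (hext (by ext; rw [hηLg]; simpa using h2))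
    · rintro (rfl | rfl)
      · exact one_pow (M := G →* Lˣ) 2
      · refine hext ?_
        change ηL (r g) ^ 2 = 1
        rw [hηLg, neg_one_sq]
  refine ⟨z, ?_⟩
  rw [huniv, Finset.prod_pair hne, ← biquadraticDet_eq_groupDet] at hz
  apply Int.cast_injective (α := L)
  rw [hz]
  simp [charSum, ηL, G, L, mul_comm]

lemma one_add_eq_neg_two_mul_sum (hp : p % 4 = 1) {x₁ y₁ : ℤ}
    (h₁ : (p : ℤ) = x₁ ^ 2 + 4 * y₁ ^ 2) (hx₁ : x₁ ≡ 1 [ZMOD 4]) :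
    1 + x₁ = -2 * ∑ h : (powMonoidHom 4 : (ZMod p)ˣ →* (ZMod p)ˣ).range,
      quadraticChar (ZMod p) ((h : (ZMod p)ˣ) + 1) := by
  have hF : ringChar (ZMod p) ≠ 2 := by rw [ZMod.ringChar_zmod_n]; omega
  have hc : 4 ∣ Fintype.card (ZMod p) - 1 := by rw [ZMod.card]; omega
  obtain ⟨k, hk⟩ := odd_sum_range_powMonoidHom_four hF
  obtain ⟨A, B, hA, hAB⟩ := exists_jacobsthalSum_two_eq hF hc
  have h4 := four_mul_sum_range_powMonoidHom_four hF hc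
  rw [hk, hA] at h4
  rw [hk]
  rw [ZMod.card] at hAB
  have hAk : A = 4 * k + 3 := by linarith
  -- `A` is odd, so an odd `B` would make `p` even.
  obtain ⟨b, hb⟩ : Even B := by
    by_contra hB
    obtain ⟨b, rfl⟩ := Int.not_even_iff_odd.mp hB
    have : (p : ℤ) = 2 * (8 * k ^ 2 + 12 * k + 2 * b ^ 2 + 2 * b + 5) := by
      rw [hAB, hAk]; ring
    omega
  have hsq := Nat.Prime.sq_eq_sq_of_eq_sq_add_mul_sq (Fact.out : p.Prime) (d := 4) (by norm_num)
    (a := A) (b := b) (by rw [hAB, hb]; ring) h₁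
  have hmod : x₁ % 4 = 1 := hx₁
  -- `A ≡ 3` and `x₁ ≡ 1` modulo 4 force `A = -x₁`.
  rcases sq_eq_sq_iff_eq_or_eq_neg.mp hsq with h | h <;> omega

end BiquadraticDeterminant

theorem theorem1p4 (p : ℕ) [Fact p.Prime] (hp : p % 4 = 1)
    (x₁ y₁ : ℤ) (h₁ : (p : ℤ) = x₁ ^ 2 + 4 * y₁ ^ 2) (hx₁ : x₁ ≡ 1 [ZMOD 4]) :
    (p % 8 = 5 →
      ∃ z : ℤ, (-2 * (biquadraticDet p : ℚ)) / (1 + (x₁ : ℚ)) = (z : ℚ) ^ 2) ∧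
    (p % 8 = 1 →
      ∀ x₂ y₂ : ℤ, (p : ℤ) = x₂ ^ 2 + 2 * y₂ ^ 2 → x₂ ≡ 1 [ZMOD 4] →
        ∃ z : ℤ, ((-1 : ℚ) ^ ((p - 1) / 8) * 2 * (biquadraticDet p : ℚ)) /
          ((1 + (x₁ : ℚ)) * (x₂ : ℚ)) = (z : ℚ) ^ 2) := by
  have hF : ringChar (ZMod p) ≠ 2 := by rw [ZMod.ringChar_zmod_n]; omega
  have hsum := one_add_eq_neg_two_mul_sum hp h₁ hx₁
  have hodd := odd_sum_range_powMonoidHom_four hF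
  set Λ := ∑ h : (powMonoidHom 4 : (ZMod p)ˣ →* (ZMod p)ˣ).range,
    quadraticChar (ZMod p) ((h : (ZMod p)ˣ) + 1) with hΛ
  have hΛ0 : (Λ : ℚ) ≠ 0 := by
    rw [Int.cast_ne_zero]; rintro h; rw [h] at hodd; exact absurd hodd (by decide)
  have hsumQ : 1 + (x₁ : ℚ) = -2 * Λ := by exact_mod_cast hsum
  constructor
  · intro hp5
    obtain ⟨z, hz⟩ := exists_biquadraticDet_eq_mul_sq hp5
    refine ⟨z, ?_⟩
    rw [hz, ← hΛ, hsumQ]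
    push_cast
    field_simp
  · intro hp1 x₂ y₂ h₂ hx₂
    have hc : 8 ∣ Fintype.card (ZMod p) - 1 := by rw [ZMod.card]; omega
    obtain ⟨η, hη⟩ := exists_char_pow_eq_quadraticChar (m := 4) hF hc four_ne_zero
    obtain ⟨z, hz⟩ := exists_biquadraticDet_eq_mul_mul_sq hp1 hη
    have hχ2 : quadraticChar (ZMod p) 2 = 1 :=
      (quadraticChar_one_iff_isSquare (Ring.two_ne_zero hF)).mpr
        ((ZMod.exists_sq_eq_two_iff (by omega)).mpr (Or.inl hp1))
    have hmod := sum_mul_quadraticChar_modEq hF hc hχ2 η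
    obtain ⟨B, hB⟩ := card_eq_sq_add_two_mul_sq hF hc hη
    rw [ZMod.card] at hB hmod
    set M := ∑ h : (powMonoidHom 4 : (ZMod p)ˣ →* (ZMod p)ˣ).range,
      (η h : ℤ) * quadraticChar (ZMod p) ((h : (ZMod p)ˣ) + 1) with hM
    have hsq := Nat.Prime.sq_eq_sq_of_eq_sq_add_mul_sq (Fact.out : p.Prime) le_rfl hB h₂
    -- `M = ±x₂`, and the residue of `M` modulo 4 selects the sign by the parity of `(p - 1) / 8`.
    have hMx : (-1) ^ ((p - 1) / 8) * M = -x₂ := by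
      rw [Int.ModEq] at hmod hx₂
      rcases Nat.even_or_odd ((p - 1) / 8) with h | h <;> rw [h.neg_one_pow] <;>
        obtain ⟨k, hk⟩ := h <;> rw [hk] at hmod <;>
        rcases sq_eq_sq_iff_eq_or_eq_neg.mp hsq with h' | h' <;> push_cast at hmod <;> omega
    have hx0 : (x₂ : ℚ) ≠ 0 := by
      rw [Int.cast_ne_zero]; rintro rfl; exact absurd hx₂ (by decide)
    have hMxQ : (-1 : ℚ) ^ ((p - 1) / 8) * M = -x₂ := by exact_mod_cast hMx
    refine ⟨z, ?_⟩
    rw [hz, ← hΛ, hsumQ]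
    push_cast
    rw [div_eq_iff (by simp [hΛ0, hx0])]
    linear_combination 2 * (Λ : ℚ) * z ^ 2 * hMxQ
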